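/- \textbf{Definitions.} A map $f\colon X\to Y$ between metric spaces is \emph{quasisymmetric} if it is a homeomorphism onto its image and there is a homeomorphism $\eta\colon[0,\infty)\to[0,\infty)$ such that $|f(x)-f(a)|\le \eta\!\left(\frac{|x-a|}{|x-b|}\right)|f(x)-f(b)|$ for all distinct $a,b,x\in X$. For $s>0$ it is \emph{$s$-quasisymmetric} if $\eta$ can be chosen with $\eta(t)\le t+s$ for $0\le t\le 1/s$. A set $\Gamma\subset\mathbb C$ is a \emph{quasisymmetric} (respectively \emph{$s$-quasisymmetric}) \emph{graph} if the projection $z\mapsto \operatorname{Re} z$ is a quasisymmetric (respectively $s$-quasisymmetric) homeomorphism of $\Gamma$ onto $\mathbb R$. A nonzero (positive) Radon measure $\mu$ on $\mathbb R$ is \emph{doubling} if there is $\delta>0$ with $\mu(I)\le(1+\delta)\mu(J)$ for any two adjacent compact intervals $I,J$ of equal length; the infimum of such $\delta$ is the \emph{doubling constant} of $\mu$. A continuous function $g\colon\mathbb R\to\mathbb R$ belongs to $\Lambda_\mu$ if there is $M>0$ with $|g(x+h)-2g(x)+g(x-h)|\le M\mu([x-h,x+h])$ for all $x\in\mathbb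 R$, $h\ge0$; the infimum of such $M$ is the \emph{seminorm} of $g$ in $\Lambda_\mu$. \textbf{Theorem.} (1) Let $\mu$ be a doubling measure on $\mathbb R$, let $u\colon\mathbb R\to\mathbb R$ be a continuous function whose distributional derivative is $\mu$, and let $v\in\Lambda_\mu$. Then $\Gamma(\mathbb R)$, where $\Gamma(t)=u(t)+iv(t)$, is a quasisymmetric graph. (2) For every $s>0$ there is $\varepsilon>0$ such that, for all $\mu,u,v$ as in (1), if the doubling constant of $\mu$ and the seminorm of $v$ in $\Lambda_\mu$ are both less than $\varepsilon$, then $\Gamma(\mathbb R)$ is an $s$-quasisymmetric graph. -/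

import Mathlib

open MeasureTheory Set
open scoped NNReal ENNReal ContDiff

/-- `f` is an `η`-quasisymmetric embedding, where `η` is a homeomorphism of `[0, ∞)`. -/
def IsQuasisymmetricWith {X Y : Type*} [MetricSpace X] [MetricSpace Y]
    (η : ℝ≥0 ≃ₜ ℝ≥0) (f : X → Y) : Prop :=
  Topology.IsEmbedding f ∧
    ∀ a b x : X, a ≠ b → x ≠ a → x ≠ b →
      nndist (f x) (f a) ≤ η (nndist x a / nndist x b) * nndist (f x) (f b)

/-- `f` is a quasisymmetric embedding. -/
def IsQuasisymmetric {X Y : Type*} [MetricSpace X] [MetricSpace Y] (f : X → Y) : Prop :=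
  ∃ η : ℝ≥0 ≃ₜ ℝ≥0, IsQuasisymmetricWith η f

/-- `f` is `s`-quasisymmetric: `η` can be chosen with `η t ≤ t + s` for `0 ≤ t ≤ 1 / s`
(used for `s > 0`). -/
def IsSQuasisymmetric {X Y : Type*} [MetricSpace X] [MetricSpace Y] (s : ℝ) (f : X → Y) : Prop :=
  ∃ η : ℝ≥0 ≃ₜ ℝ≥0, IsQuasisymmetricWith η f ∧
    ∀ t : ℝ≥0, (t : ℝ) ≤ 1 / s → (η t : ℝ) ≤ (t : ℝ) + s

/-- The orthogonal projection of a planar set to the real axis. -/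
def realProj (Γ : Set ℂ) : Γ → ℝ := fun z => (z : ℂ).re

/-- `Γ` is a quasisymmetric graph: its projection is a quasisymmetric homeomorphism onto `ℝ`. -/
def IsQuasisymmetricGraph (Γ : Set ℂ) : Prop :=
  IsHomeomorph (realProj Γ) ∧ IsQuasisymmetric (realProj Γ)

/-- `Γ` is an `s`-quasisymmetric graph. -/
def IsSQuasisymmetricGraph (s : ℝ) (Γ : Set ℂ) : Prop :=
  IsHomeomorph (realProj Γ) ∧ IsSQuasisymmetric s (realProj Γ)

/-- `μ I ≤ (1 + δ) μ J` for all adjacent compact intervals `I`, `J` of equal length, in either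
order. -/
def DoublingWith (μ : Measure ℝ) (δ : ℝ) : Prop :=
  ∀ x h : ℝ, 0 < h →
    μ (Icc (x - h) x) ≤ ENNReal.ofReal (1 + δ) * μ (Icc x (x + h)) ∧
    μ (Icc x (x + h)) ≤ ENNReal.ofReal (1 + δ) * μ (Icc (x - h) x)

/-- A nonzero measure is doubling if it is doubling with some constant `δ > 0`. It is a Radon
measure as soon as it is locally finite. -/
def IsDoubling (μ : Measure ℝ) : Prop :=
  μ ≠ 0 ∧ ∃ δ : ℝ, 0 < δ ∧ DoublingWith μ δ

/-- The doubling constant: the infimum of the admissible `δ > 0`. -/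
noncomputable def doublingConstant (μ : Measure ℝ) : ℝ :=
  sInf {δ : ℝ | 0 < δ ∧ DoublingWith μ δ}

/-- The generalized Zygmund condition with constant `M`. -/
def ZygmundWith (μ : Measure ℝ) (g : ℝ → ℝ) (M : ℝ) : Prop :=
  ∀ x h : ℝ, 0 ≤ h →
    |g (x + h) - 2 * g x + g (x - h)| ≤ M * μ.real (Icc (x - h) (x + h))

/-- Membership in the generalized Zygmund class `Λ_μ`. -/
def MemZygmund (μ : Measure ℝ) (g : ℝ → ℝ) : Prop :=
  Continuous g ∧ ∃ M : ℝ, 0 < M ∧ ZygmundWith μ g M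

/-- The seminorm of `g` in `Λ_μ`: the infimum of the admissible `M > 0`. -/
noncomputable def zygmundSeminorm (μ : Measure ℝ) (g : ℝ → ℝ) : ℝ :=
  sInf {M : ℝ | 0 < M ∧ ZygmundWith μ g M}

/-- `u` is a continuous function whose distributional derivative is the measure `μ`. -/
def HasMeasureDeriv (u : ℝ → ℝ) (μ : Measure ℝ) : Prop :=
  Continuous u ∧ ∀ φ : ℝ → ℝ, ContDiff ℝ ∞ φ → HasCompactSupport φ →
    ∫ x, u x * deriv φ x = - ∫ x, φ x ∂μ

/-- The image of `ℝ` under `t ↦ u t + i v t`. -/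
def curveImage (u v : ℝ → ℝ) : Set ℂ :=
  range fun t : ℝ => (u t : ℂ) + Complex.I * (v t : ℂ)

open Filter Topology

/-! Put F = u + iv. The projection sends F(t) to u(t), so it is u ∘ F⁻¹, and it suffices that the
parametrizations t ↦ u(t) and t ↦ F(t) are quasisymmetric on the line with moduli depending only on
δ and M.

Doubling makes the increments of u decay like a power of t on the intervals [x, x + th]. The Zygmund
condition keeps v within M times the increment of u of its linear interpolation
(`abs_sub_interpolation_le`), so the increments of F decay like a power too; second differences
bound their growth for large t. Hence F is quasisymmetric with a power modulus (`norm_le_add_rpow`),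
and so is u, the case v = 0. Inverting the estimate for F and composing it with that for u gives
part (1).

For part (2), small δ and M make F and u nearly affine on any bounded range of scales
(`exists_forall_norm_sub_linear_le`). The ratios of distances for u and for F are then both close to
|x - a| / |x - b|, hence to each other. Large ratios are handled by the fixed modulus of part (1)
for δ = M = 1.

On the measure side one only needs that μ([a, b]) = u(b) - u(a) and that u is strictly increasing.
-/

/-- An increasing function `u` that is doubling with constant `δ`, together with a continuous
function `v` that is Zygmund relative to `u` with constant `M`. Here `h` may have either sign. -/
structure DoublingPair (δ M : ℝ) (u v : ℝ → ℝ) : Prop where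
  δ_pos : 0 < δ
  M_pos : 0 < M
  mono : StrictMono u
  cont_u : Continuous u
  dbl : ∀ x h, |u (x - h) - u x| ≤ (1 + δ) * |u (x + h) - u x|
  cont : Continuous v
  zyg : ∀ x h, |v (x + h) - 2 * v x + v (x - h)| ≤ M * |u (x + h) - u (x - h)|

/-- The parametrized curve `t ↦ u t + i v t`. -/
noncomputable def curve (u v : ℝ → ℝ) (t : ℝ) : ℂ := (u t : ℂ) + Complex.I * (v t : ℂ)

@[simp] lemma curve_re (u v : ℝ → ℝ) (t : ℝ) : (curve u v t).re = u t := by simp [curve]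

@[simp] lemma curve_im (u v : ℝ → ℝ) (t : ℝ) : (curve u v t).im = v t := by simp [curve]

/-! ### Increments of monotone functions and deviation from linear interpolation. -/

lemma StrictMono.abs_sub_add {u : ℝ → ℝ} (hu : StrictMono u) (x h : ℝ) {t : ℝ}
    (h0 : 0 ≤ t) (h1 : t ≤ 1) :
    |u (x + h) - u x| = |u (x + h) - u (x + t * h)| + |u (x + t * h) - u x| := by
  rcases le_total 0 h with hh | hh
  · have a1 : u x ≤ u (x + t * h) := hu.monotone (by nlinarith)
    have a2 : u (x + t * h) ≤ u (x + h) := hu.monotone (by nlinarith)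
    rw [abs_of_nonneg (by linarith), abs_of_nonneg (by linarith), abs_of_nonneg (by linarith)]
    ring
  · have a1 : u (x + t * h) ≤ u x := hu.monotone (by nlinarith)
    have a2 : u (x + h) ≤ u (x + t * h) := hu.monotone (by nlinarith)
    rw [abs_of_nonpos (by linarith), abs_of_nonpos (by linarith), abs_of_nonpos (by linarith)]
    ring

lemma StrictMono.abs_sub_le {u : ℝ → ℝ} (hu : StrictMono u) (x h : ℝ) {t : ℝ}
    (h0 : 0 ≤ t) (h1 : t ≤ 1) : |u (x + t * h) - u x| ≤ |u (x + h) - u x| := by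
  have := hu.abs_sub_add x h h0 h1
  have := abs_nonneg (u (x + h) - u (x + t * h))
  linarith

/-- A function that is Zygmund relative to `u` deviates from its linear interpolation on an
interval by at most the increment of `u`. -/
lemma abs_sub_interpolation_le {u v : ℝ → ℝ} {M : ℝ} (hu : StrictMono u) (hM : 0 ≤ M)
    (hv : Continuous v)
    (hz : ∀ x h, |v (x + h) - 2 * v x + v (x - h)| ≤ M * |u (x + h) - u (x - h)|)
    (x h : ℝ) {t : ℝ} (h0 : 0 ≤ t) (h1 : t ≤ 1) :
    |v (x + t * h) - v x - t * (v (x + h) - v x)| ≤ M * |u (x + h) - u x| := by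
  set φ : ℝ → ℝ := fun t => v (x + t * h) - v x - t * (v (x + h) - v x) with hφ
  have hc : Continuous φ := by fun_prop
  -- Maximum principle. `φ` vanishes at 0 and 1, and its second differences are those of `v`.
  -- Centring one at a maximum point `s` of |φ|, with step reaching the nearer end of [0, 1], gives
  -- 2|φ(s)| ≤ |φ(s)| + M |u(x + h) - u(x)|.
  obtain ⟨s, ⟨hs0, hs1⟩, hs⟩ := isCompact_Icc.exists_isMaxOn (nonempty_Icc.2 zero_le_one)
    (f := fun t => |φ t|) hc.abs.continuousOn
  have hs' : ∀ r, 0 ≤ r → r ≤ 1 → |φ r| ≤ |φ s| := fun r hr0 hr1 => hs ⟨hr0, hr1⟩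
  refine (hs' t h0 h1).trans ?_
  rcases le_total s (1 / 2) with hh | hh
  · have hz1 := hz (x + s * h) (s * h)
    have e : φ (2 * s) - 2 * φ s =
        v (x + s * h + s * h) - 2 * v (x + s * h) + v (x + s * h - s * h) := by
      simp only [hφ]
      rw [show x + s * h + s * h = x + 2 * s * h by ring, add_sub_cancel_right]
      ring
    rw [← e, show x + s * h + s * h = x + 2 * s * h by ring, add_sub_cancel_right] at hz1
    have b1 := hs' (2 * s) (by linarith) (by linarith)
    have b2 := mul_le_mul_of_nonneg_left
      (hu.abs_sub_le x h (t := 2 * s) (by linarith) (by linarith)) hM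
    have b3 : 2 * |φ s| ≤ |φ (2 * s)| + |φ (2 * s) - 2 * φ s| := by
      have := abs_sub_abs_le_abs_sub (2 * φ s) (φ (2 * s))
      rw [abs_mul, abs_two, abs_sub_comm (2 * φ s)] at this
      linarith
    linarith
  · have hz1 := hz (x + s * h) ((1 - s) * h)
    have e1 : x + s * h + (1 - s) * h = x + h := by ring
    have e2 : x + s * h - (1 - s) * h = x + (2 * s - 1) * h := by ring
    have e : φ (2 * s - 1) - 2 * φ s =
        v (x + h) - 2 * v (x + s * h) + v (x + (2 * s - 1) * h) := by
      simp only [hφ]; ring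
    rw [e1, e2, ← e] at hz1
    have b1 := hs' (2 * s - 1) (by linarith) (by linarith)
    have b2 := hu.abs_sub_add x h (t := 2 * s - 1) (by linarith) (by linarith)
    have b4 : M * |u (x + h) - u (x + (2 * s - 1) * h)| ≤ M * |u (x + h) - u x| :=
      mul_le_mul_of_nonneg_left (by linarith [abs_nonneg (u (x + (2 * s - 1) * h) - u x)]) hM
    have b3 : 2 * |φ s| ≤ |φ (2 * s - 1)| + |φ (2 * s - 1) - 2 * φ s| := by
      have := abs_sub_abs_le_abs_sub (2 * φ s) (φ (2 * s - 1))
      rw [abs_mul, abs_two, abs_sub_comm (2 * φ s)] at this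
      linarith
    linarith

/-! ### Power bounds for the increments of u and of the curve. -/

/-- The Hölder exponent of a doubling increasing function. -/
noncomputable def holderExp (δ : ℝ) : ℝ := Real.logb 2 ((2 + δ) / (1 + δ))

lemma holderExp_pos {δ : ℝ} (hδ : 0 < δ) : 0 < holderExp δ := by
  apply Real.logb_pos one_lt_two
  rw [lt_div_iff₀ (by linarith)]; linarith

lemma holderExp_le_one {δ : ℝ} (hδ : 0 < δ) : holderExp δ ≤ 1 := by
  have : holderExp δ ≤ Real.logb 2 2 := by
    apply Real.logb_le_logb_of_le one_lt_two (by positivity)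
    rw [div_le_iff₀ (by linarith)]; linarith
  simpa using this

lemma two_rpow_holderExp {δ : ℝ} (hδ : 0 < δ) :
    (2 : ℝ) ^ holderExp δ = (2 + δ) / (1 + δ) :=
  Real.rpow_logb two_pos (by norm_num) (by positivity)

namespace DoublingPair

variable {δ M : ℝ} {u v : ℝ → ℝ}

/-- For v = 0 distances along the curve are those of u, so each estimate for the curve contains one
for u. -/
lemma zero (H : DoublingPair δ M u v) : DoublingPair δ M u 0 :=
  ⟨H.δ_pos, H.M_pos, H.mono, H.cont_u, H.dbl, continuous_zero, fun x h => by
    have := H.M_pos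
    simp only [Pi.zero_apply, mul_zero, sub_zero, add_zero, abs_zero]
    positivity⟩

lemma weaken (H : DoublingPair δ M u v) {δ' M' : ℝ} (hδ : δ ≤ δ') (hM : M ≤ M') :
    DoublingPair δ' M' u v :=
  ⟨H.δ_pos.trans_le hδ, H.M_pos.trans_le hM, H.mono, H.cont_u,
    fun x h => (H.dbl x h).trans (by gcongr), H.cont, fun x h => (H.zyg x h).trans (by gcongr)⟩

lemma abs_u_le (u v : ℝ → ℝ) (x y : ℝ) : |u y - u x| ≤ ‖curve u v y - curve u v x‖ := by
  simpa using Complex.abs_re_le_norm (curve u v y - curve u v x)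

lemma abs_v_le (u v : ℝ → ℝ) (x y : ℝ) : |v y - v x| ≤ ‖curve u v y - curve u v x‖ := by
  simpa using Complex.abs_im_le_norm (curve u v y - curve u v x)

lemma norm_le (u v : ℝ → ℝ) (x y : ℝ) :
    ‖curve u v y - curve u v x‖ ≤ |u y - u x| + |v y - v x| := by
  simpa using Complex.norm_le_abs_re_add_abs_im (curve u v y - curve u v x)

lemma norm_zero (u : ℝ → ℝ) (x y : ℝ) : ‖curve u 0 y - curve u 0 x‖ = |u y - u x| := by
  simp only [curve, Pi.zero_apply, Complex.ofReal_zero, mul_zero, add_zero]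
  rw [← Complex.ofReal_sub, Complex.norm_real, Real.norm_eq_abs]

/-- The second difference is the difference of two adjacent increments, whose ratio doubling keeps
between 1 / (1 + δ) and 1 + δ. -/
lemma abs_second_diff_le (H : DoublingPair δ M u v) (x h : ℝ) :
    |u (x + h) - 2 * u x + u (x - h)| ≤ δ * |u (x + h) - u x| := by
  have hδ := H.δ_pos
  have d1 := H.dbl x h
  have d2 := H.dbl x (-h)
  rw [sub_neg_eq_add, ← sub_eq_add_neg] at d2
  rcases le_total 0 h with hh | hh
  · have a1 : u x ≤ u (x + h) := H.mono.monotone (by linarith)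
    have a2 : u (x - h) ≤ u x := H.mono.monotone (by linarith)
    rw [abs_of_nonneg (a := u (x + h) - u x) (by linarith),
      abs_of_nonpos (a := u (x - h) - u x) (by linarith)] at *
    rw [abs_le]
    constructor <;> nlinarith
  · have a1 : u (x + h) ≤ u x := H.mono.monotone (by linarith)
    have a2 : u x ≤ u (x - h) := H.mono.monotone (by linarith)
    rw [abs_of_nonpos (a := u (x + h) - u x) (by linarith),
      abs_of_nonneg (a := u (x - h) - u x) (by linarith)] at *
    rw [abs_le]
    constructor <;> nlinarith

lemma abs_sub_eq_add (H : DoublingPair δ M u v) (x h : ℝ) :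
    |u (x + h) - u (x - h)| = |u (x + h) - u x| + |u (x - h) - u x| := by
  have := H.mono.abs_sub_add (x - h) (2 * h) (t := 1 / 2) (by norm_num) (by norm_num)
  rw [show x - h + 2 * h = x + h by ring, show x - h + 1 / 2 * (2 * h) = x by ring] at this
  rw [this, abs_sub_comm (u x)]

/-- The increasing function of a doubling pair is Zygmund relative to itself. -/
lemma zyg_self (H : DoublingPair δ M u v) (x h : ℝ) :
    |u (x + h) - 2 * u x + u (x - h)| ≤ δ * |u (x + h) - u (x - h)| := by
  refine (H.abs_second_diff_le x h).trans (mul_le_mul_of_nonneg_left ?_ H.δ_pos.le)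
  rw [H.abs_sub_eq_add]
  linarith [abs_nonneg (u (x - h) - u x)]

/-- The real part contributes δ. For the imaginary part, u(x + h) - u(x - h) is at most 2 + δ times
the one-sided increment, in absolute value. -/
lemma norm_second_diff_le (H : DoublingPair δ M u v) (x h : ℝ) :
    ‖curve u v (x + h) - 2 * curve u v x + curve u v (x - h)‖ ≤
      (δ + M * (2 + δ)) * ‖curve u v (x + h) - curve u v x‖ := by
  have hδ := H.δ_pos
  have hM := H.M_pos
  have h1 := Complex.norm_le_abs_re_add_abs_im
    (curve u v (x + h) - 2 * curve u v x + curve u v (x - h))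
  simp only [Complex.add_re, Complex.sub_re, Complex.mul_re, curve_re, Complex.re_ofNat,
    Complex.im_ofNat, zero_mul, sub_zero, Complex.add_im, Complex.sub_im, Complex.mul_im,
    curve_im, add_zero] at h1
  have h2 := H.abs_second_diff_le x h
  have h3 := H.zyg x h
  rw [H.abs_sub_eq_add] at h3
  have h4 := mul_le_mul_of_nonneg_left (H.dbl x h) hM.le
  calc _ ≤ _ := h1
    _ ≤ (δ + M * (2 + δ)) * |u (x + h) - u x| := by nlinarith
    _ ≤ _ := by gcongr; exact abs_u_le u v x (x + h)

lemma norm_reflect_le (H : DoublingPair δ M u v) (x h : ℝ) :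
    ‖curve u v (x - h) - curve u v x‖ ≤
      (1 + (δ + M * (2 + δ))) * ‖curve u v (x + h) - curve u v x‖ := by
  have h1 := H.norm_second_diff_le x h
  have h2 := norm_sub_le (curve u v (x + h) - 2 * curve u v x + curve u v (x - h))
    (curve u v (x + h) - curve u v x)
  rw [show curve u v (x + h) - 2 * curve u v x + curve u v (x - h) -
    (curve u v (x + h) - curve u v x) = curve u v (x - h) - curve u v x by ring] at h2
  linarith

lemma norm_double_le (H : DoublingPair δ M u v) (x h : ℝ) :
    ‖curve u v (x + 2 * h) - curve u v x‖ ≤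
      (2 + (δ + M * (2 + δ))) * ‖curve u v (x + h) - curve u v x‖ := by
  have h1 := H.norm_second_diff_le (x + h) (-h)
  rw [sub_neg_eq_add, add_neg_cancel_right, add_assoc, ← two_mul,
    norm_sub_rev (curve u v x)] at h1
  have h2 := norm_add_le (curve u v x - 2 * curve u v (x + h) + curve u v (x + 2 * h))
    (2 * (curve u v (x + h) - curve u v x))
  rw [show curve u v x - 2 * curve u v (x + h) + curve u v (x + 2 * h) +
    2 * (curve u v (x + h) - curve u v x) = curve u v (x + 2 * h) - curve u v x by ring,
    norm_mul, Complex.norm_ofNat] at h2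
  linarith

/-- The near half of the increment is at most 1 + δ times the far half, and the two add up to the
whole. -/
lemma abs_half_le (H : DoublingPair δ M u v) (x h : ℝ) :
    |u (x + (1 / 2) * h) - u x| ≤ (1 + δ) / (2 + δ) * |u (x + h) - u x| := by
  have hδ := H.δ_pos
  have h1 := H.mono.abs_sub_add x h (t := 1 / 2) (by norm_num) (by norm_num)
  have h2 := H.dbl (x + (1 / 2) * h) ((1 / 2) * h)
  rw [add_sub_cancel_right, add_assoc, ← add_mul, add_halves, one_mul, abs_sub_comm (u x)] at h2
  rw [h1, div_mul_eq_mul_div (1 + δ), le_div_iff₀ (by linarith)]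
  nlinarith

lemma abs_half_pow_le (H : DoublingPair δ M u v) (x h : ℝ) (n : ℕ) :
    |u (x + (1 / 2) ^ n * h) - u x| ≤ ((1 + δ) / (2 + δ)) ^ n * |u (x + h) - u x| := by
  have hδ := H.δ_pos
  induction n with
  | zero => simp
  | succ n ih =>
    have := H.abs_half_le x ((1 / 2) ^ n * h)
    rw [← mul_assoc, ← pow_succ'] at this
    refine this.trans ?_
    rw [pow_succ', mul_assoc]
    gcongr

/-- Hölder bound for the increments of a doubling function. -/
lemma abs_le_rpow (H : DoublingPair δ M u v) (x h : ℝ) {t : ℝ} (h0 : 0 ≤ t) (h1 : t ≤ 1) :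
    |u (x + t * h) - u x| ≤ 2 * t ^ holderExp δ * |u (x + h) - u x| := by
  have hδ := H.δ_pos
  have hα := holderExp_pos hδ
  rcases h0.eq_or_lt with rfl | h0
  · simp [Real.zero_rpow hα.ne']
  -- Dyadic scale with (1/2)^(n+1) < t ≤ (1/2)^n; rounding up to it costs 2 ^ `holderExp δ` ≤ 2.
  obtain ⟨n, hn1, hn2⟩ := exists_nat_pow_near_of_lt_one h0 h1 (y := (1 / 2 : ℝ)) (by norm_num)
    (by norm_num)
  have e1 : x + t * h = x + (t / (1 / 2) ^ n) * ((1 / 2) ^ n * h) := by field_simp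
  have b1 := H.mono.abs_sub_le x ((1 / 2) ^ n * h) (t := t / (1 / 2) ^ n) (by positivity)
    (by rw [div_le_one (by positivity)]; exact hn2)
  rw [← e1] at b1
  refine b1.trans ((H.abs_half_pow_le x h n).trans ?_)
  gcongr
  have e2 : (1 + δ) / (2 + δ) = (1 / 2 : ℝ) ^ holderExp δ := by
    rw [Real.div_rpow zero_le_one zero_le_two, Real.one_rpow, two_rpow_holderExp hδ, one_div_div]
  calc ((1 + δ) / (2 + δ)) ^ n = ((1 / 2 : ℝ) ^ n) ^ holderExp δ := by
        rw [e2, ← Real.rpow_natCast, ← Real.rpow_natCast, ← Real.rpow_mul (by norm_num),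
          ← Real.rpow_mul (by norm_num), mul_comm]
    _ ≤ (2 * t) ^ holderExp δ := by
        apply Real.rpow_le_rpow (by positivity) _ hα.le
        rw [pow_succ] at hn1; linarith
    _ = 2 ^ holderExp δ * t ^ holderExp δ := Real.mul_rpow zero_le_two h0.le
    _ ≤ 2 * t ^ holderExp δ := by
        gcongr
        simpa using Real.rpow_le_rpow_of_exponent_le one_le_two (holderExp_le_one hδ)

/-- Hölder bound for the increments of the curve. -/
lemma norm_le_rpow (H : DoublingPair δ M u v) (x h : ℝ) {t : ℝ} (h0 : 0 ≤ t) (h1 : t ≤ 1) :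
    ‖curve u v (x + t * h) - curve u v x‖ ≤
      (3 + 3 * M) * t ^ (holderExp δ / 2) * ‖curve u v (x + h) - curve u v x‖ := by
  have hδ := H.δ_pos
  have hM := H.M_pos
  have hα := holderExp_pos hδ
  have hα1 := holderExp_le_one hδ
  set N := ‖curve u v (x + h) - curve u v x‖ with hN
  have hN0 : 0 ≤ N := norm_nonneg _
  set w := t ^ (holderExp δ / 2) with hw
  have hw0 : 0 ≤ w := Real.rpow_nonneg h0 _
  -- Interpolating once, from 1 to t, leaves an error M that does not decay. Passing through √t
  -- makes the first error acquire a factor √t, while the second is relative to the increment of u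
  -- at scale √t, already a power of t. This is why the exponent is halved.
  set s := √t with hs
  have hs0 : 0 ≤ s := Real.sqrt_nonneg _
  have hs1 : s ≤ 1 := Real.sqrt_le_one.2 h1
  have hss : s * s = t := Real.mul_self_sqrt h0
  have hsw : s ^ holderExp δ = w := by
    rw [hs, Real.sqrt_eq_rpow, ← Real.rpow_mul h0, hw]; ring_nf
  have hswl : s ≤ w := by
    rw [← hsw]
    rcases hs0.eq_or_lt with h | h
    · rw [← h, Real.zero_rpow hα.ne']
    · simpa using Real.rpow_le_rpow_of_exponent_ge h hs1 hα1
  have hw1 : w ≤ 1 := Real.rpow_le_one h0 h1 (by positivity)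
  have hu := abs_u_le u v x (x + h)
  have hv := abs_v_le u v x (x + h)
  have a1 := H.abs_le_rpow x h h0 h1
  have a2 : t ^ holderExp δ ≤ w := by
    have : t ^ holderExp δ = w * w := by
      rw [hw, ← Real.rpow_add_of_nonneg h0 (by positivity) (by positivity), add_halves]
    rw [this]; nlinarith
  have a3 := H.abs_le_rpow x h hs0 hs1
  rw [hsw] at a3
  have b1 := abs_sub_interpolation_le H.mono hM.le H.cont H.zyg x h hs0 hs1
  have b2 := abs_sub_interpolation_le H.mono hM.le H.cont H.zyg x (s * h) hs0 hs1
  rw [← mul_assoc, hss] at b2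
  have c1 : |v (x + s * h) - v x| ≤ s * N + M * N := by
    have := abs_sub_abs_le_abs_sub (v (x + s * h) - v x) (s * (v (x + h) - v x))
    rw [abs_mul, abs_of_nonneg hs0] at this
    nlinarith
  have c2 : |v (x + t * h) - v x| ≤ s * (s * N + M * N) + M * (2 * w * N) := by
    have := abs_sub_abs_le_abs_sub (v (x + t * h) - v x) (s * (v (x + s * h) - v x))
    rw [abs_mul, abs_of_nonneg hs0] at this
    have e1 := mul_le_mul_of_nonneg_left c1 hs0
    have e2 : |u (x + s * h) - u x| ≤ 2 * w * N := a3.trans (by gcongr)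
    have e3 := mul_le_mul_of_nonneg_left e2 hM.le
    linarith
  have c3 : |u (x + t * h) - u x| ≤ 2 * w * N := a1.trans (by gcongr)
  have c4 := norm_le u v x (x + t * h)
  have d1 : s * (s * N) ≤ w * N := by
    have : s * N ≤ w * N := by gcongr
    have : s * (s * N) ≤ 1 * (s * N) := by gcongr
    linarith
  have d2 : s * (M * N) ≤ w * (M * N) := by gcongr
  nlinarith

/-- The exponent of growth of the increments of the curve. -/
noncomputable def _root_.growthExp (δ M : ℝ) : ℝ := Real.logb 2 (2 + (δ + M * (2 + δ)))

lemma growthExp_pos (H : DoublingPair δ M u v) : 0 < growthExp δ M := by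
  have := H.δ_pos
  have := H.M_pos
  have : 0 < M * (2 + δ) := by positivity
  exact Real.logb_pos one_lt_two (by linarith)

lemma norm_two_pow_le (H : DoublingPair δ M u v) (x h : ℝ) (n : ℕ) :
    ‖curve u v (x + 2 ^ n * h) - curve u v x‖ ≤
      (2 + (δ + M * (2 + δ))) ^ n * ‖curve u v (x + h) - curve u v x‖ := by
  have := H.δ_pos
  have := H.M_pos
  induction n with
  | zero => simp
  | succ n ih =>
    have := H.norm_double_le x (2 ^ n * h)
    rw [← mul_assoc, ← pow_succ'] at this
    refine this.trans ?_
    rw [pow_succ', mul_assoc]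
    gcongr

lemma norm_le_rpow_of_one_le (H : DoublingPair δ M u v) (x h : ℝ) {t : ℝ} (h1 : 1 ≤ t) :
    ‖curve u v (x + t * h) - curve u v x‖ ≤
      (3 + 3 * M) * (2 + (δ + M * (2 + δ))) * t ^ growthExp δ M *
        ‖curve u v (x + h) - curve u v x‖ := by
  have hδ := H.δ_pos
  have hM := H.M_pos
  have hp := H.growthExp_pos
  set K := 2 + (δ + M * (2 + δ)) with hK
  have hK0 : 0 < K := by positivity
  -- Here 2^n ≤ t < 2^(n+1): double n + 1 times, then return to t by the bound for t ≤ 1.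
  obtain ⟨n, hn1, hn2⟩ := exists_nat_pow_near h1 (y := (2 : ℝ)) one_lt_two
  have e1 : x + t * h = x + (t / 2 ^ (n + 1)) * (2 ^ (n + 1) * h) := by field_simp
  have ht1 : t / 2 ^ (n + 1) ≤ 1 := by rw [div_le_one (by positivity)]; exact hn2.le
  have b1 := H.norm_le_rpow x (2 ^ (n + 1) * h) (t := t / 2 ^ (n + 1)) (by positivity) ht1
  rw [← e1] at b1
  have b2 := H.norm_two_pow_le x h (n + 1)
  have b3 : (t / 2 ^ (n + 1)) ^ (holderExp δ / 2) ≤ 1 :=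
    Real.rpow_le_one (by positivity) ht1 (by have := holderExp_pos hδ; positivity)
  have b4 : K ^ n ≤ t ^ growthExp δ M := by
    have : K = (2 : ℝ) ^ growthExp δ M := (Real.rpow_logb two_pos (by norm_num) hK0).symm
    calc K ^ n = ((2 : ℝ) ^ n) ^ growthExp δ M := by
          rw [this, ← Real.rpow_natCast, ← Real.rpow_natCast, ← Real.rpow_mul (by norm_num),
            ← Real.rpow_mul (by norm_num), mul_comm]
      _ ≤ _ := Real.rpow_le_rpow (by positivity) hn1 hp.le
  calc _ ≤ _ := b1
    _ ≤ (3 + 3 * M) * 1 * (K ^ (n + 1) * ‖curve u v (x + h) - curve u v x‖) := by gcongr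
    _ = (3 + 3 * M) * K * K ^ n * ‖curve u v (x + h) - curve u v x‖ := by ring
    _ ≤ _ := by gcongr

/-- The constant in the power quasisymmetry of the curve. -/
noncomputable def _root_.powerConst (δ M : ℝ) : ℝ :=
  (3 + 3 * M) * (2 + (δ + M * (2 + δ))) * (1 + (δ + M * (2 + δ)))

lemma powerConst_pos (H : DoublingPair δ M u v) : 0 < powerConst δ M := by
  have := H.δ_pos
  have := H.M_pos
  unfold powerConst
  positivity

/-- The curve is quasisymmetric with a power modulus. -/
lemma norm_le_add_rpow (H : DoublingPair δ M u v) (x h t : ℝ) :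
    ‖curve u v (x + t * h) - curve u v x‖ ≤
      powerConst δ M * (|t| ^ (holderExp δ / 2) + |t| ^ growthExp δ M) *
        ‖curve u v (x + h) - curve u v x‖ := by
  have hδ := H.δ_pos
  have hM := H.M_pos
  have key : ∀ h, ∀ t, 0 ≤ t → ‖curve u v (x + t * h) - curve u v x‖ ≤
      (3 + 3 * M) * (2 + (δ + M * (2 + δ))) * (t ^ (holderExp δ / 2) + t ^ growthExp δ M) *
        ‖curve u v (x + h) - curve u v x‖ := by
    intro h t ht
    have p1 : 0 ≤ t ^ growthExp δ M := Real.rpow_nonneg ht _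
    have p2 : 0 ≤ t ^ (holderExp δ / 2) := Real.rpow_nonneg ht _
    rcases le_total t 1 with h1 | h1
    · refine (H.norm_le_rpow x h ht h1).trans ?_
      gcongr
      · have : 0 ≤ M * (2 + δ) := by positivity
        exact le_mul_of_one_le_right (by positivity) (by linarith)
      · linarith
    · refine (H.norm_le_rpow_of_one_le x h h1).trans ?_
      gcongr
      linarith
  have q : 0 ≤ |t| ^ (holderExp δ / 2) + |t| ^ growthExp δ M := by positivity
  rcases le_total 0 t with ht | ht
  · have := key h t ht
    rw [abs_of_nonneg ht] at q ⊢
    refine this.trans ?_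
    gcongr
    unfold powerConst
    have : 0 ≤ M * (2 + δ) := by positivity
    exact le_mul_of_one_le_right (by positivity) (by linarith)
  · have := key (-h) (-t) (by linarith)
    rw [neg_mul_neg, ← sub_eq_add_neg] at this
    rw [abs_of_nonpos ht] at q ⊢
    refine this.trans ((mul_le_mul_of_nonneg_left (H.norm_reflect_le x h) (by positivity)).trans ?_)
    apply le_of_eq
    unfold powerConst
    ring

/-! ### Closeness of the curve to affine maps. -/

lemma norm_sub_interpolation_le (H : DoublingPair δ M u v) (x h : ℝ) {t : ℝ} (h0 : 0 ≤ t)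
    (h1 : t ≤ 1) :
    ‖curve u v (x + t * h) - curve u v x - t * (curve u v (x + h) - curve u v x)‖ ≤
      (δ + M) * ‖curve u v (x + h) - curve u v x‖ := by
  have hδ := H.δ_pos
  have hM := H.M_pos
  have b1 := abs_sub_interpolation_le H.mono hM.le H.cont H.zyg x h h0 h1
  have b2 := abs_sub_interpolation_le H.mono hδ.le H.cont_u H.zyg_self x h h0 h1
  have b3 := Complex.norm_le_abs_re_add_abs_im
    (curve u v (x + t * h) - curve u v x - t * (curve u v (x + h) - curve u v x))
  simp only [Complex.sub_re, Complex.mul_re, curve_re, Complex.ofReal_re, Complex.ofReal_im,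
    zero_mul, sub_zero, Complex.sub_im, Complex.mul_im, curve_im, add_zero] at b3
  calc _ ≤ _ := b3
    _ ≤ (δ + M) * |u (x + h) - u x| := by linarith
    _ ≤ _ := by gcongr; exact abs_u_le u v x (x + h)

/-- For small constants the curve is uniformly close to an affine map on bounded ranges of
scales. -/
lemma exists_forall_norm_sub_linear_le (R : ℝ) (hR : 1 ≤ R) :
    ∃ C : ℝ, 0 < C ∧ ∀ (δ M : ℝ) (u v : ℝ → ℝ), DoublingPair δ M u v → δ ≤ 1 → M ≤ 1 →
      ∀ x h t : ℝ, |t| ≤ R →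
        ‖curve u v (x + t * h) - curve u v x - t * (curve u v (x + h) - curve u v x)‖ ≤
          (δ + M) * C * ‖curve u v (x + h) - curve u v x‖ := by
  set G := powerConst 1 1 * (R ^ (holderExp 1 / 2) + R ^ growthExp 1 1) with hG
  have hG0 : 0 < G := by
    unfold powerConst at hG
    rw [hG]
    positivity
  -- The extra factors serve negative t: 5 is the reflection constant for δ = M = 1, and 3 comes
  -- from δ + M (2 + δ) ≤ 3 (δ + M).
  refine ⟨5 * (1 + R * G) + 3 * R, by positivity, ?_⟩
  intro δ M u v H hδ1 hM1 x h t ht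
  have hδ := H.δ_pos
  have hM := H.M_pos
  have H1 := H.weaken hδ1 hM1
  have key : ∀ h t, 0 ≤ t → t ≤ R →
      ‖curve u v (x + t * h) - curve u v x - t * (curve u v (x + h) - curve u v x)‖ ≤
        (δ + M) * (1 + R * G) * ‖curve u v (x + h) - curve u v x‖ := by
    intro h t h0 hR'
    rcases le_total t 1 with h1 | h1
    · refine (H.norm_sub_interpolation_le x h h0 h1).trans ?_
      gcongr
      exact le_mul_of_one_le_right (by positivity) (by linarith [show 0 < R * G by positivity])
    -- Beyond the interval the roles are exchanged: x + h lies at the fraction t⁻¹ of [x, x + t h],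
    -- and `G` bounds the longer chord by the shorter one.
    · have ht0 : 0 < t := by linarith
      have b1 := H.norm_sub_interpolation_le x (t * h) (t := t⁻¹) (by positivity)
        (inv_le_one_of_one_le₀ h1)
      rw [inv_mul_cancel_left₀ ht0.ne'] at b1
      have b2 := H1.norm_le_add_rpow x h t
      rw [abs_of_nonneg h0] at b2
      have b3 : ‖curve u v (x + t * h) - curve u v x‖ ≤
          G * ‖curve u v (x + h) - curve u v x‖ := by
        refine b2.trans ?_
        have := H1.powerConst_pos
        have h3 := holderExp_pos one_pos
        have h4 := H1.growthExp_pos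
        rw [hG]
        gcongr
      have htc : (t : ℂ) ≠ 0 := by exact_mod_cast ht0.ne'
      have e : curve u v (x + t * h) - curve u v x - t * (curve u v (x + h) - curve u v x) =
          -(t * (curve u v (x + h) - curve u v x -
            (t⁻¹ : ℝ) * (curve u v (x + t * h) - curve u v x))) := by
        push_cast
        field_simp
        ring
      rw [e, norm_neg, norm_mul, Complex.norm_real, Real.norm_eq_abs, abs_of_nonneg h0]
      calc _ ≤ R * ((δ + M) * (G * ‖curve u v (x + h) - curve u v x‖)) := by
            gcongr
            exact b1.trans (by gcongr)
        _ = (δ + M) * (R * G) * ‖curve u v (x + h) - curve u v x‖ := by ring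
        _ ≤ _ := by gcongr; linarith
  set N := ‖curve u v (x + h) - curve u v x‖ with hN
  have hN0 : 0 ≤ N := norm_nonneg _
  rcases le_total 0 t with h0 | h0
  · rw [abs_of_nonneg h0] at ht
    refine (key h t h0 ht).trans ?_
    have hle : 1 + R * G ≤ 5 * (1 + R * G) + 3 * R := by
      linarith [show 0 < R * G by positivity]
    gcongr
  · rw [abs_of_nonpos h0] at ht
    have b1 := key (-h) (-t) (by linarith) ht
    rw [neg_mul_neg, ← sub_eq_add_neg] at b1
    have b2 := H1.norm_reflect_le x h
    have b3 := H.norm_second_diff_le x h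
    have e : curve u v (x + t * h) - curve u v x - t * (curve u v (x + h) - curve u v x) =
        (curve u v (x + t * h) - curve u v x -
          ((-t : ℝ) : ℂ) * (curve u v (x - h) - curve u v x)) +
        ((-t : ℝ) : ℂ) * (curve u v (x + h) - 2 * curve u v x + curve u v (x - h)) := by
      push_cast
      ring
    rw [e]
    refine (norm_add_le _ _).trans ?_
    rw [norm_mul, Complex.norm_real, Real.norm_eq_abs, abs_of_nonneg (a := -t) (by linarith)]
    have c1 : (δ + M) * (1 + R * G) * ‖curve u v (x - h) - curve u v x‖ ≤
        (δ + M) * (1 + R * G) * (5 * N) := by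
      gcongr
      linarith
    have c2 : -t * ‖curve u v (x + h) - 2 * curve u v x + curve u v (x - h)‖ ≤
        R * ((3 * (δ + M)) * N) := by
      gcongr
      refine b3.trans ?_
      gcongr
      nlinarith
    calc _ ≤ _ := add_le_add (b1.trans c1) c2
      _ = _ := by ring

end DoublingPair

/-! ### From the distributional derivative to increments of u. -/

lemma deriv_smoothTransition_of_notMem {x : ℝ} (hx : x ∉ Icc (0 : ℝ) 1) :
    deriv Real.smoothTransition x = 0 := by
  rw [mem_Icc, not_and_or, not_le, not_le] at hx
  rcases hx with hx | hx
  · have : Real.smoothTransition =ᶠ[𝓝 x] fun _ => 0 := by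
      filter_upwards [Iio_mem_nhds hx] with y hy using Real.smoothTransition.zero_of_nonpos hy.le
    rw [this.deriv_eq, deriv_const]
  · have : Real.smoothTransition =ᶠ[𝓝 x] fun _ => 1 := by
      filter_upwards [Ioi_mem_nhds hx] with y hy using Real.smoothTransition.one_of_one_le hy.le
    rw [this.deriv_eq, deriv_const]

lemma continuous_deriv_smoothTransition : Continuous (deriv Real.smoothTransition) :=
  (Real.smoothTransition.contDiff (n := 1)).continuous_deriv le_rfl

lemma integral_deriv_smoothTransition :
    ∫ t in (0 : ℝ)..1, deriv Real.smoothTransition t = 1 := by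
  rw [intervalIntegral.integral_deriv_eq_sub
    (fun x _ => (Real.smoothTransition.contDiff (n := 1)).differentiable one_ne_zero x)
    (continuous_deriv_smoothTransition.intervalIntegrable _ _)]
  simp

/-- The smooth step from `0` to `1` on `[c, c + r]`. -/
noncomputable def smoothStep (r c x : ℝ) : ℝ := Real.smoothTransition (r⁻¹ * (x - c))

lemma contDiff_smoothStep (r c : ℝ) : ContDiff ℝ ∞ (smoothStep r c) :=
  Real.smoothTransition.contDiff.comp (by fun_prop)

lemma deriv_smoothStep (r c x : ℝ) :
    deriv (smoothStep r c) x = r⁻¹ * deriv Real.smoothTransition (r⁻¹ * (x - c)) := by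
  have h1 : HasDerivAt (fun x : ℝ => r⁻¹ * (x - c)) r⁻¹ x := by
    simpa using ((hasDerivAt_id x).sub_const c).const_mul r⁻¹
  have h2 := ((Real.smoothTransition.contDiff (n := 1)).differentiable one_ne_zero
    (r⁻¹ * (x - c))).hasDerivAt.comp x h1
  rw [mul_comm]
  exact h2.deriv

lemma hasCompactSupport_deriv_smoothStep {r : ℝ} (hr : 0 < r) (c : ℝ) :
    HasCompactSupport (deriv (smoothStep r c)) := by
  apply HasCompactSupport.intro (K := Icc c (c + r)) isCompact_Icc
  intro x hx
  rw [deriv_smoothStep, deriv_smoothTransition_of_notMem, mul_zero]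
  contrapose! hx
  obtain ⟨h1, h2⟩ := hx
  rw [inv_mul_le_iff₀ hr] at h2
  have : 0 ≤ x - c := by
    by_contra! h
    have := mul_neg_of_pos_of_neg (inv_pos.2 hr) h
    linarith
  constructor <;> linarith

lemma integrable_mul_deriv_smoothStep {u : ℝ → ℝ} (hu : Continuous u) {r : ℝ} (hr : 0 < r)
    (c : ℝ) : Integrable fun x => u x * deriv (smoothStep r c) x :=
  (hu.mul ((contDiff_smoothStep r c).continuous_deriv (by simp))).integrable_of_hasCompactSupport
    (hasCompactSupport_deriv_smoothStep hr c).mul_left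

lemma integral_mul_deriv_smoothStep (u : ℝ → ℝ) {r : ℝ} (hr : 0 < r) (c : ℝ) :
    ∫ x, u x * deriv (smoothStep r c) x =
      ∫ t in (0 : ℝ)..1, u (c + r * t) * deriv Real.smoothTransition t := by
  have h1 := Measure.integral_comp_mul_left
    (fun y => u (c + y) * deriv (smoothStep r c) (c + y)) r
  rw [integral_add_left_eq_self (fun y => u y * deriv (smoothStep r c) y) c,
    abs_of_pos (inv_pos.2 hr), smul_eq_mul, eq_inv_mul_iff_mul_eq₀ hr.ne'] at h1
  rw [← h1, ← integral_const_mul, intervalIntegral.integral_of_le zero_le_one,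
    ← integral_Icc_eq_integral_Ioc, setIntegral_eq_integral_of_forall_compl_eq_zero]
  · congr 1
    ext t
    rw [deriv_smoothStep, add_sub_cancel_left, inv_mul_cancel_left₀ hr.ne']
    field_simp
  · intro t ht
    rw [deriv_smoothTransition_of_notMem ht, mul_zero]

lemma tendsto_integral_mul_deriv_smoothStep {u : ℝ → ℝ} (hu : Continuous u) (c : ℝ) :
    Tendsto (fun r => ∫ x, u x * deriv (smoothStep r c) x) (𝓝[>] 0) (𝓝 (u c)) := by
  have h1 : Continuous fun r => ∫ t in (0 : ℝ)..1, u (c + r * t) * deriv Real.smoothTransition t :=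
    intervalIntegral.continuous_parametric_intervalIntegral_of_continuous'
      (by have := continuous_deriv_smoothTransition; unfold Function.uncurry; fun_prop) _ _
  have h2 := (h1.tendsto 0).mono_left (nhdsWithin_le_nhds (s := Ioi 0))
  simp only [zero_mul, add_zero, intervalIntegral.integral_const_mul,
    integral_deriv_smoothTransition, mul_one] at h2
  refine h2.congr' ?_
  filter_upwards [self_mem_nhdsWithin] with r hr
  exact (integral_mul_deriv_smoothStep u hr c).symm

lemma smoothStep_of_le {r c x : ℝ} (hr : 0 < r) (h : x ≤ c) : smoothStep r c x = 0 :=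
  Real.smoothTransition.zero_of_nonpos
    (mul_nonpos_of_nonneg_of_nonpos (inv_pos.2 hr).le (by linarith))

lemma smoothStep_of_ge {r c x : ℝ} (hr : 0 < r) (h : c + r ≤ x) : smoothStep r c x = 1 :=
  Real.smoothTransition.one_of_one_le (by rw [le_inv_mul_iff₀ hr]; linarith)

lemma smoothStep_tendsto (c x : ℝ) :
    Tendsto (fun r => smoothStep r c x) (𝓝[>] 0) (𝓝 ((Ioi c).indicator 1 x)) := by
  apply tendsto_const_nhds.congr'
  rcases le_or_gt x c with h | h
  · filter_upwards [self_mem_nhdsWithin] with r hr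
    rw [smoothStep_of_le hr h, indicator_of_notMem (by simpa using h)]
  · filter_upwards [Ioo_mem_nhdsGT (sub_pos.2 h)] with r hr
    rw [smoothStep_of_ge hr.1 (by linarith [hr.2]), indicator_of_mem (by simpa using h)]
    rfl

/-- A continuous primitive of a measure computes its mass on half-open intervals. -/
lemma HasMeasureDeriv.measureReal_Ioc {u : ℝ → ℝ} {μ : Measure ℝ} [IsLocallyFiniteMeasure μ]
    (hu : HasMeasureDeriv u μ) {a b : ℝ} (hab : a ≤ b) : μ.real (Ioc a b) = u b - u a := by
  obtain ⟨hc, hd⟩ := hu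
  -- The test function steps up at a and down at b. As r → 0 its derivative acts on u as a
  -- difference of point masses, while the function tends to the indicator of (a, b], each smooth
  -- step vanishing at its left end.
  have h1 : Tendsto (fun r => -∫ x, (smoothStep r a x - smoothStep r b x) ∂μ) (𝓝[>] 0)
      (𝓝 (u a - u b)) := by
    refine ((tendsto_integral_mul_deriv_smoothStep hc a).sub
      (tendsto_integral_mul_deriv_smoothStep hc b)).congr' ?_
    filter_upwards [self_mem_nhdsWithin] with r (hr : 0 < r)
    rw [← integral_sub (integrable_mul_deriv_smoothStep hc hr a)
      (integrable_mul_deriv_smoothStep hc hr b), ← hd (fun x => smoothStep r a x - smoothStep r b x)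
      ((contDiff_smoothStep r a).sub (contDiff_smoothStep r b))]
    · congr 1
      ext x
      rw [deriv_fun_sub ((contDiff_smoothStep r a).differentiable (by simp) x)
        ((contDiff_smoothStep r b).differentiable (by simp) x), mul_sub]
    · apply HasCompactSupport.intro (K := Icc a (b + r)) isCompact_Icc
      intro x hx
      rw [mem_Icc, not_and_or, not_le, not_le] at hx
      rcases hx with hx | hx
      · rw [smoothStep_of_le hr hx.le, smoothStep_of_le hr (hx.le.trans hab), sub_zero]
      · rw [smoothStep_of_ge hr hx.le, smoothStep_of_ge hr (by linarith), sub_self]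
  have h2 : Tendsto (fun r => ∫ x, (smoothStep r a x - smoothStep r b x) ∂μ) (𝓝[>] 0)
      (𝓝 (∫ x, ((Ioi a).indicator 1 x - (Ioi b).indicator 1 x) ∂μ)) := by
    apply tendsto_integral_filter_of_dominated_convergence
      ((Icc a (b + 1)).indicator (fun _ => (1 : ℝ)))
    · exact Eventually.of_forall fun r =>
        ((contDiff_smoothStep r a).continuous.sub
          (contDiff_smoothStep r b).continuous).aestronglyMeasurable
    · filter_upwards [Ioo_mem_nhdsGT (zero_lt_one' ℝ)] with r hr
      refine Eventually.of_forall fun x => ?_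
      by_cases hx : x ∈ Icc a (b + 1)
      · rw [indicator_of_mem hx, Real.norm_eq_abs, abs_le]
        have := Real.smoothTransition.nonneg (r⁻¹ * (x - a))
        have := Real.smoothTransition.nonneg (r⁻¹ * (x - b))
        have := Real.smoothTransition.le_one (r⁻¹ * (x - a))
        have := Real.smoothTransition.le_one (r⁻¹ * (x - b))
        unfold smoothStep
        constructor <;> linarith
      · rw [indicator_of_notMem hx]
        rw [mem_Icc, not_and_or, not_le, not_le] at hx
        rcases hx with hx | hx
        · rw [smoothStep_of_le hr.1 hx.le, smoothStep_of_le hr.1 (hx.le.trans hab), sub_zero,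
            norm_zero]
        · rw [smoothStep_of_ge hr.1 (by linarith [hr.2]),
            smoothStep_of_ge hr.1 (by linarith [hr.2]), sub_self, norm_zero]
    · exact (integrable_indicator_iff measurableSet_Icc).2
        (integrableOn_const (by exact isCompact_Icc.measure_lt_top.ne))
    · exact Eventually.of_forall fun x => (smoothStep_tendsto a x).sub (smoothStep_tendsto b x)
  have h3 := tendsto_nhds_unique h1 h2.neg
  have h4 : (fun x => (Ioi a).indicator (1 : ℝ → ℝ) x - (Ioi b).indicator 1 x) =
      (Ioc a b).indicator 1 := by
    ext x
    by_cases h5 : a < x <;> by_cases h6 : x ≤ b <;> simp [indicator, h5, h6, not_lt.2]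
    · simp [not_le.1 h6]
    · linarith
  rw [h4, integral_indicator_one measurableSet_Ioc] at h3
  linarith

/-- Continuity of u rules out an atom at a: enclose [a, b] in (a - r, b] and let r → 0. -/
lemma HasMeasureDeriv.measureReal_Icc {u : ℝ → ℝ} {μ : Measure ℝ} [IsLocallyFiniteMeasure μ]
    (hu : HasMeasureDeriv u μ) {a b : ℝ} (hab : a ≤ b) : μ.real (Icc a b) = u b - u a := by
  have h0 : μ.real (Icc a b) ≤ u b - u a := by
    have h1 : Tendsto (fun r => u b - u (a - r)) (𝓝[>] 0) (𝓝 (u b - u a)) := by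
      have : Continuous fun r => u b - u (a - r) := by have := hu.1; fun_prop
      simpa using (this.tendsto 0).mono_left nhdsWithin_le_nhds
    refine ge_of_tendsto h1 ?_
    filter_upwards [self_mem_nhdsWithin] with r (hr : 0 < r)
    rw [← hu.measureReal_Ioc (by linarith)]
    exact measureReal_mono (fun x hx => ⟨by linarith [hx.1], hx.2⟩)
      (isCompact_Icc.measure_lt_top.trans_le' (measure_mono Ioc_subset_Icc_self)).ne
  refine le_antisymm h0 ?_
  rw [← hu.measureReal_Ioc hab]
  exact measureReal_mono Ioc_subset_Icc_self isCompact_Icc.measure_lt_top.ne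

lemma DoublingWith.sub_le {u : ℝ → ℝ} {μ : Measure ℝ} [IsLocallyFiniteMeasure μ] {δ : ℝ}
    (hδ : 0 < δ) (hμ : DoublingWith μ δ) (hu : HasMeasureDeriv u μ) (x : ℝ) {h : ℝ}
    (hh : 0 < h) :
    u x - u (x - h) ≤ (1 + δ) * (u (x + h) - u x) ∧
      u (x + h) - u x ≤ (1 + δ) * (u x - u (x - h)) := by
  have fin : ∀ a b, μ (Icc a b) ≠ ⊤ := fun a b => isCompact_Icc.measure_lt_top.ne
  rw [← hu.measureReal_Icc (by linarith), ← hu.measureReal_Icc (by linarith)]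
  obtain ⟨h1, h2⟩ := hμ x h hh
  constructor
  · have := ENNReal.toReal_mono (ENNReal.mul_ne_top ENNReal.ofReal_ne_top (fin _ _)) h1
    rwa [ENNReal.toReal_mul, ENNReal.toReal_ofReal (by linarith)] at this
  · have := ENNReal.toReal_mono (ENNReal.mul_ne_top ENNReal.ofReal_ne_top (fin _ _)) h2
    rwa [ENNReal.toReal_mul, ENNReal.toReal_ofReal (by linarith)] at this

lemma HasMeasureDeriv.monotone {u : ℝ → ℝ} {μ : Measure ℝ} [IsLocallyFiniteMeasure μ]
    (hu : HasMeasureDeriv u μ) : Monotone u := fun a b hab => by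
  have := hu.measureReal_Icc hab
  have : 0 ≤ μ.real (Icc a b) := measureReal_nonneg
  linarith

lemma HasMeasureDeriv.strictMono {u : ℝ → ℝ} {μ : Measure ℝ} [IsLocallyFiniteMeasure μ]
    (hu : HasMeasureDeriv u μ) (h0 : μ ≠ 0) {δ : ℝ} (hδ : 0 < δ) (hμ : DoublingWith μ δ) :
    StrictMono u := by
  refine hu.monotone.strictMono_of_injective ?_
  by_contra hinj
  have hex : ∃ a b, a < b ∧ u a = u b := by
    simp only [Function.Injective, not_forall] at hinj
    obtain ⟨a, b, hab, hne⟩ := hinj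
    rcases lt_or_gt_of_ne hne with h | h
    · exact ⟨a, b, h, hab⟩
    · exact ⟨b, a, h, hab.symm⟩
  obtain ⟨a, b, hab, he⟩ := hex
  set h := b - a with hh
  have hpos : 0 < h := by linarith
  -- If u is constant on [a, b], doubling spreads this to the adjacent interval of equal length,
  -- then to ever longer ones on both sides of a. These exhaust the line, so μ would vanish.
  have key : ∀ n : ℕ, u (a - 2 ^ n * h) = u (a + 2 ^ n * h) := by
    intro n
    have h3 : ∀ r, 0 ≤ r → u (a + r) = u a → u (a - r) = u (a + r) := by
      intro r hr hr'
      rcases hr.eq_or_lt with rfl | hr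
      · simp
      have := (hμ.sub_le hδ hu a hr).1
      have := hu.monotone (show a - r ≤ a by linarith)
      rw [hr'] at *
      linarith
    apply h3 _ (by positivity)
    induction n with
    | zero => rw [pow_zero, one_mul, hh, add_sub_cancel, he]
    | succ n ih =>
      have h1 := (hμ.sub_le hδ hu (a + 2 ^ n * h) (h := 2 ^ n * h) (by positivity)).2
      rw [add_sub_cancel_right, ih, sub_self, mul_zero] at h1
      have h2 := hu.monotone (show a ≤ a + 2 ^ n * h + 2 ^ n * h by
        have : 0 < 2 ^ n * h := by positivity
        linarith)
      rw [show a + 2 ^ (n + 1) * h = a + 2 ^ n * h + 2 ^ n * h by ring]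
      linarith
  apply h0
  rw [← Measure.measure_univ_eq_zero]
  have hU : (univ : Set ℝ) = ⋃ n : ℕ, Icc (a - 2 ^ n * h) (a + 2 ^ n * h) := by
    symm
    rw [eq_univ_iff_forall]
    intro x
    obtain ⟨n, hn⟩ := pow_unbounded_of_one_lt (|x - a| / h) (one_lt_two (α := ℝ))
    rw [div_lt_iff₀ hpos, abs_lt] at hn
    exact mem_iUnion.2 ⟨n, by linarith [hn.1], by linarith [hn.2]⟩
  rw [hU, measure_iUnion_null_iff]
  intro n
  have h1 := hu.measureReal_Icc (a := a - 2 ^ n * h) (b := a + 2 ^ n * h) (by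
    have : 0 < 2 ^ n * h := by positivity
    linarith)
  rw [key, sub_self, measureReal_eq_zero_iff isCompact_Icc.measure_lt_top.ne] at h1
  exact h1

lemma DoublingPair.of_measure {u v : ℝ → ℝ} {μ : Measure ℝ} [IsLocallyFiniteMeasure μ]
    (hu : HasMeasureDeriv u μ) (h0 : μ ≠ 0) {δ M : ℝ} (hδ : 0 < δ) (hμ : DoublingWith μ δ)
    (hM : 0 < M) (hc : Continuous v) (hv : ZygmundWith μ v M) : DoublingPair δ M u v := by
  have hmono := hu.monotone
  refine ⟨hδ, hM, hu.strictMono h0 hδ hμ, hu.1, ?_, hc, ?_⟩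
  · intro x h
    rcases lt_trichotomy h 0 with hh | rfl | hh
    · have := (hμ.sub_le hδ hu x (neg_pos.2 hh)).2
      rw [sub_neg_eq_add, ← sub_eq_add_neg] at this
      rw [abs_of_nonneg (by linarith [hmono (show x ≤ x - h by linarith)]),
        abs_of_nonpos (by linarith [hmono (show x + h ≤ x by linarith)])]
      linarith
    · simp
    · have := (hμ.sub_le hδ hu x hh).1
      rw [abs_of_nonpos (by linarith [hmono (show x - h ≤ x by linarith)]),
        abs_of_nonneg (by linarith [hmono (show x ≤ x + h by linarith)])]
      linarith
  · have key : ∀ x h, 0 ≤ h →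
        |v (x + h) - 2 * v x + v (x - h)| ≤ M * |u (x + h) - u (x - h)| := by
      intro x h hh
      rw [← hu.measureReal_Icc (show x - h ≤ x + h by linarith), abs_of_nonneg measureReal_nonneg]
      exact hv x h hh
    intro x h
    rcases le_total 0 h with hh | hh
    · exact key x h hh
    · have := key x (-h) (by linarith)
      rw [sub_neg_eq_add, ← sub_eq_add_neg, abs_sub_comm (u _)] at this
      rwa [show v (x + h) - 2 * v x + v (x - h) = v (x - h) - 2 * v x + v (x + h) by ring]

/-! ### Homeomorphisms of [0, ∞) and comparison of ratios. -/

lemma NNReal.exists_orderIso_eq {f : ℝ≥0 → ℝ≥0} (hc : Continuous f) (hm : StrictMono f)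
    (h0 : f 0 = 0) (ht : ∀ y, ∃ x, y ≤ f x) : ∃ g : ℝ≥0 ≃o ℝ≥0, ∀ t, g t = f t := by
  have hs : Function.Surjective f := fun y =>
    mem_range_of_exists_le_of_exists_ge hc ⟨0, by simp [h0]⟩ (ht y)
  exact ⟨hm.orderIsoOfSurjective f hs, fun t => rfl⟩

lemma NNReal.exists_orderIso_add_rpow {c : ℝ≥0} (hc : 0 < c) {a b : ℝ} (ha : 0 < a)
    (hb : 0 < b) : ∃ g : ℝ≥0 ≃o ℝ≥0, ∀ t, g t = c * (t ^ a + t ^ b) := by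
  apply NNReal.exists_orderIso_eq
  · have := NNReal.continuous_rpow_const ha.le
    have := NNReal.continuous_rpow_const hb.le
    fun_prop
  · intro x y hxy
    have := NNReal.strictMono_rpow_of_pos ha hxy
    have := NNReal.strictMono_rpow_of_pos hb hxy
    dsimp only at *
    gcongr
  · simp [ha.ne', hb.ne']
  · intro y
    refine ⟨(y / c) ^ a⁻¹, ?_⟩
    rw [← NNReal.rpow_mul, inv_mul_cancel₀ ha.ne', NNReal.rpow_one, mul_add,
      mul_div_cancel₀ _ hc.ne']
    exact le_self_add

lemma add_div_mul_sub_cancel {x a b : ℝ} (hb : x ≠ b) :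
    x + (a - x) / (b - x) * (b - x) = a := by
  rw [div_mul_cancel₀ _ (sub_ne_zero.2 hb.symm)]; ring

namespace DoublingPair

variable {δ M : ℝ} {u v : ℝ → ℝ}

lemma dist_curve_le (H : DoublingPair δ M u v) {x a b : ℝ} (hb : x ≠ b) :
    dist (curve u v x) (curve u v a) ≤
      powerConst δ M * ((dist x a / dist x b) ^ (holderExp δ / 2) +
        (dist x a / dist x b) ^ growthExp δ M) * dist (curve u v x) (curve u v b) := by
  have := H.norm_le_add_rpow x (b - x) ((a - x) / (b - x))
  rw [add_div_mul_sub_cancel hb, add_sub_cancel, abs_div] at this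
  rw [dist_comm, dist_comm x a, dist_comm x b, dist_comm (curve u v x)]
  simpa only [dist_eq_norm, Real.norm_eq_abs] using this

/-- Quasisymmetry, in both directions, of the parametrization relative to `u` and to the curve. -/
lemma exists_orderIso_bound {δ M : ℝ} (hδ : 0 < δ) (hM : 0 < M) :
    ∃ g₀ g₁ : ℝ≥0 ≃o ℝ≥0, ∀ u v : ℝ → ℝ, DoublingPair δ M u v → ∀ a b x : ℝ, x ≠ a → x ≠ b →
      nndist (u x) (u a) ≤ g₀ (nndist x a / nndist x b) * nndist (u x) (u b) ∧
      nndist x a / nndist x b ≤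
        g₁ (nndist (curve u v x) (curve u v a) / nndist (curve u v x) (curve u v b)) := by
  have hα : 0 < holderExp δ / 2 := by have := holderExp_pos hδ; positivity
  have hp : 0 < growthExp δ M := by
    have : 0 < M * (2 + δ) := by positivity
    exact Real.logb_pos one_lt_two (by linarith)
  have hA : 0 < powerConst δ M := by unfold powerConst; positivity
  set α := holderExp δ / 2
  set p := growthExp δ M
  lift powerConst δ M to ℝ≥0 using hA.le with A hAeq
  have hA' : 0 < A := by exact_mod_cast hA
  obtain ⟨g₀, hg₀⟩ := NNReal.exists_orderIso_add_rpow hA' hα hp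
  have hc : 0 < (2 * A) ^ α⁻¹ + (2 * A) ^ p⁻¹ := by positivity
  obtain ⟨g₁, hg₁⟩ := NNReal.exists_orderIso_add_rpow hc (inv_pos.2 hα) (inv_pos.2 hp)
  refine ⟨g₀, g₁, fun u v H a b x hxa hxb => ?_⟩
  have key : ∀ v, DoublingPair δ M u v → ∀ a b, x ≠ b →
      nndist (curve u v x) (curve u v a) ≤
        A * ((nndist x a / nndist x b) ^ α + (nndist x a / nndist x b) ^ p) *
          nndist (curve u v x) (curve u v b) := by
    intro v H a b hb
    have := H.dist_curve_le (a := a) hb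
    rw [← hAeq] at this
    exact_mod_cast this
  constructor
  · have := key 0 H.zero a b hxb
    have e : ∀ y, nndist (curve u 0 x) (curve u 0 y) = nndist (u x) (u y) := by
      intro y
      apply NNReal.eq
      rw [coe_nndist, coe_nndist, dist_eq_norm, norm_zero, Real.dist_eq]
    rw [hg₀]
    simpa only [e] using this
  · have h1 := key v H b a hxa
    have hFb : nndist (curve u v x) (curve u v b) ≠ 0 := by
      rw [Ne, nndist_eq_zero]
      intro h
      have := congrArg Complex.re h
      simp only [curve_re] at this
      exact hxb (H.mono.injective this)
    -- The estimate for F with a and b exchanged is a lower bound for τ in terms of l⁻¹. Whichever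
    -- of the two powers is larger may replace both, at the cost of a factor 2, and the resulting
    -- pure power is inverted.
    rw [← inv_div (nndist x a)] at h1
    have hl : 0 < nndist x a / nndist x b :=
      div_pos (pos_iff_ne_zero.2 (nndist_eq_zero.not.2 hxa))
        (pos_iff_ne_zero.2 (nndist_eq_zero.not.2 hxb))
    set l := nndist x a / nndist x b
    set τ := nndist (curve u v x) (curve u v a) / nndist (curve u v x) (curve u v b) with hτ
    have h2 : 1 ≤ A * (l⁻¹ ^ α + l⁻¹ ^ p) * τ := by
      rw [hτ, ← mul_div_assoc, one_le_div₀ (pos_iff_ne_zero.2 hFb)]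
      exact h1
    have aux : ∀ q : ℝ, 0 < q → 1 ≤ A * (l⁻¹ ^ q + l⁻¹ ^ q) * τ →
        l ≤ (2 * A) ^ q⁻¹ * τ ^ q⁻¹ := by
      intro q hq h
      rw [← NNReal.mul_rpow, NNReal.le_rpow_inv_iff hq]
      rw [NNReal.inv_rpow, ← two_mul] at h
      have h3 : 0 < l ^ q := NNReal.rpow_pos hl
      calc l ^ q ≤ l ^ q * (A * (2 * (l ^ q)⁻¹) * τ) := le_mul_of_one_le_right' h
        _ = 2 * A * τ := by field_simp
    rw [hg₁]
    rcases le_total (l⁻¹ ^ α) (l⁻¹ ^ p) with h | h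
    · refine (aux p hp (h2.trans (by gcongr))).trans ?_
      gcongr
      · exact le_add_self
      · exact le_add_self
    · refine (aux α hα (h2.trans (by gcongr))).trans ?_
      gcongr
      · exact le_self_add
      · exact le_self_add

lemma abs_dist_curve_sub_le {C : ℝ} {x a b : ℝ} (hb : x ≠ b)
    (h : ‖curve u v (x + (a - x) / (b - x) * (b - x)) - curve u v x -
      ((a - x) / (b - x) : ℝ) * (curve u v (x + (b - x)) - curve u v x)‖ ≤
        C * ‖curve u v (x + (b - x)) - curve u v x‖) :
    |dist (curve u v x) (curve u v a) - dist x a / dist x b * dist (curve u v x) (curve u v b)| ≤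
      C * dist (curve u v x) (curve u v b) := by
  rw [add_div_mul_sub_cancel hb, add_sub_cancel] at h
  have h2 := abs_norm_sub_norm_le (curve u v a - curve u v x)
    (((a - x) / (b - x) : ℝ) * (curve u v b - curve u v x))
  rw [norm_mul, Complex.norm_real, norm_div] at h2
  rw [dist_comm, dist_comm x a, dist_comm x b, dist_comm (curve u v x)]
  simp only [dist_eq_norm]
  exact h2.trans h

/-- For small constants, the ratios of distances of `u` and of the curve are close. -/
lemma exists_forall_dist_le (R σ : ℝ) (hR : 1 ≤ R) (hσ : 0 < σ) :
    ∃ ε : ℝ, 0 < ε ∧ ε ≤ 1 ∧ ∀ (δ M : ℝ) (u v : ℝ → ℝ), DoublingPair δ M u v → δ < ε → M < ε →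
      ∀ a b x : ℝ, x ≠ b → dist x a / dist x b ≤ R →
        dist (u x) (u a) ≤
          (dist (curve u v x) (curve u v a) / dist (curve u v x) (curve u v b) + σ) *
            dist (u x) (u b) := by
  obtain ⟨C, hC0, hC⟩ := exists_forall_norm_sub_linear_le R hR
  -- Then (δ + M) C ≤ σ / 2: one half of σ pays for passing from the curve to the line, the other
  -- for passing from the line to u.
  refine ⟨min 1 (σ / (4 * C)), by positivity, min_le_left _ _, ?_⟩
  intro δ M u v H hδ hM a b x hb hl
  have hδ1 := (hδ.trans_le (min_le_left _ _)).le
  have hM1 := (hM.trans_le (min_le_left _ _)).le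
  have hδ2 := hδ.trans_le (min_le_right _ _)
  have hM2 := hM.trans_le (min_le_right _ _)
  rw [lt_div_iff₀ (by positivity)] at hδ2 hM2
  have hs : (δ + M) * C ≤ σ / 2 := by linarith
  have ht : |(a - x) / (b - x)| ≤ R := by
    rw [abs_div, ← Real.dist_eq, ← Real.dist_eq, dist_comm a, dist_comm b]
    exact hl
  have k1 := abs_le.1 (abs_dist_curve_sub_le hb
    (hC δ M u v H hδ1 hM1 x (b - x) ((a - x) / (b - x)) ht))
  have k2 := abs_le.1 (abs_dist_curve_sub_le hb
    (hC δ M u 0 H.zero hδ1 hM1 x (b - x) ((a - x) / (b - x)) ht))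
  have e : ∀ y, dist (curve u 0 x) (curve u 0 y) = dist (u x) (u y) := fun y => by
    rw [dist_eq_norm, norm_zero, Real.dist_eq]
  rw [e, e] at k2
  have hpos : 0 < dist (u x) (u b) := dist_pos.2 (H.mono.injective.ne hb)
  have hFpos : 0 < dist (curve u v x) (curve u v b) := by
    refine dist_pos.2 fun h => hb (H.mono.injective ?_)
    simpa using congrArg Complex.re h
  have k3 : dist x a / dist x b ≤
      dist (curve u v x) (curve u v a) / dist (curve u v x) (curve u v b) + σ / 2 := by
    rw [← sub_le_iff_le_add, le_div_iff₀ hFpos]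
    have := mul_le_mul_of_nonneg_right hs hFpos.le
    linarith [k1.1]
  calc dist (u x) (u a) ≤ (dist x a / dist x b + (δ + M) * C) * dist (u x) (u b) := by
        linarith [k2.2]
    _ ≤ _ := mul_le_mul_of_nonneg_right (by linarith) hpos.le

/-! ### The projection as a homeomorphism, and the two conclusions. -/

/-- Halving 2^n h back to h shrinks the increment geometrically, so the increments over 2^n h are
unbounded. -/
lemma exists_le_abs_sub (H : DoublingPair δ M u v) {h : ℝ} (hh : h ≠ 0) (B : ℝ) :
    ∃ n : ℕ, B ≤ |u (0 + 2 ^ n * h) - u 0| := by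
  have hδ := H.δ_pos
  have hpos : 0 < |u (0 + h) - u 0| :=
    abs_pos.2 (sub_ne_zero.2 (H.mono.injective.ne (by simpa using hh)))
  obtain ⟨n, hn⟩ := exists_pow_lt_of_lt_one (show 0 < |u (0 + h) - u 0| / (|B| + 1) by positivity)
    (show (1 + δ) / (2 + δ) < 1 by rw [div_lt_one (by linarith)]; linarith)
  refine ⟨n, ?_⟩
  have h1 := H.abs_half_pow_le 0 (2 ^ n * h) n
  rw [← mul_assoc, ← mul_pow, one_div_mul_cancel two_ne_zero, one_pow, one_mul] at h1
  rw [lt_div_iff₀ (by positivity)] at hn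
  by_contra! hlt
  have h2 : |u (0 + 2 ^ n * h) - u 0| < |B| + 1 := by linarith [le_abs_self B]
  have h3 : 0 < ((1 + δ) / (2 + δ)) ^ n := by positivity
  nlinarith

lemma surjective (H : DoublingPair δ M u v) : Function.Surjective u := by
  intro y
  apply mem_range_of_exists_le_of_exists_ge H.cont_u
  · obtain ⟨n, hn⟩ := H.exists_le_abs_sub (h := -1) (by norm_num) (u 0 - y)
    refine ⟨0 + 2 ^ n * -1, ?_⟩
    have : u (0 + 2 ^ n * -1) ≤ u 0 := H.mono.monotone (by
      have : (0 : ℝ) < 2 ^ n := by positivity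
      linarith)
    rw [abs_of_nonpos (by linarith)] at hn
    linarith
  · obtain ⟨n, hn⟩ := H.exists_le_abs_sub (h := 1) (by norm_num) (y - u 0)
    refine ⟨0 + 2 ^ n * 1, ?_⟩
    have : u 0 ≤ u (0 + 2 ^ n * 1) := H.mono.monotone (by
      have : (0 : ℝ) < 2 ^ n := by positivity
      linarith)
    rw [abs_of_nonneg (by linarith)] at hn
    linarith

lemma isHomeomorph_realProj (H : DoublingPair δ M u v) :
    IsHomeomorph (realProj (curveImage u v)) := by
  -- The inverse of the projection is the curve composed with u⁻¹.
  set e := (H.mono.orderIsoOfSurjective u H.surjective).toHomeomorph with he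
  have hcurve : Continuous (curve u v) := by
    have := H.cont_u
    have := H.cont
    unfold curve
    fun_prop
  rw [isHomeomorph_iff_exists_inverse]
  refine ⟨Complex.continuous_re.comp continuous_subtype_val,
    fun y => ⟨curve u v (e.symm y), e.symm y, rfl⟩, ?_, ?_, ?_⟩
  · rintro ⟨_, t, rfl⟩
    apply Subtype.ext
    have : realProj (curveImage u v) ⟨curve u v t, t, rfl⟩ = e t := curve_re u v t
    change curve u v (e.symm (realProj (curveImage u v) ⟨curve u v t, t, rfl⟩)) = curve u v t
    rw [this, e.symm_apply_apply]
  · intro y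
    have : (curve u v (e.symm y)).re = e (e.symm y) := curve_re u v _
    rw [e.apply_symm_apply] at this
    exact this
  · exact (hcurve.comp e.symm.continuous).subtype_mk _

lemma isQuasisymmetricWith_realProj (H : DoublingPair δ M u v) {g : ℝ≥0 ≃o ℝ≥0}
    (hg : ∀ a b x : ℝ, x ≠ a → x ≠ b → nndist (u x) (u a) ≤
      g (nndist (curve u v x) (curve u v a) / nndist (curve u v x) (curve u v b)) *
        nndist (u x) (u b)) :
    IsQuasisymmetricWith g.toHomeomorph (realProj (curveImage u v)) := by
  refine ⟨H.isHomeomorph_realProj.isEmbedding, ?_⟩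
  rintro ⟨_, a, rfl⟩ ⟨_, b, rfl⟩ ⟨_, x, rfl⟩ - hxa hxb
  have e : ∀ t, realProj (curveImage u v) ⟨curve u v t, t, rfl⟩ = u t := curve_re u v
  have := hg a b x (fun h => hxa (by simp [h])) (fun h => hxb (by simp [h]))
  rw [← e, ← e, ← e] at this
  exact this

lemma isQuasisymmetricGraph (H : DoublingPair δ M u v) :
    IsQuasisymmetricGraph (curveImage u v) := by
  obtain ⟨g₀, g₁, hg⟩ := exists_orderIso_bound H.δ_pos H.M_pos
  refine ⟨H.isHomeomorph_realProj, (g₁.trans g₀).toHomeomorph,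
    H.isQuasisymmetricWith_realProj fun a b x ha hb => ?_⟩
  obtain ⟨h1, h2⟩ := hg u v H a b x ha hb
  refine h1.trans ?_
  gcongr
  exact g₀.monotone h2

lemma exists_forall_isSQuasisymmetricGraph {s : ℝ} (hs : 0 < s) :
    ∃ ε : ℝ, 0 < ε ∧ ∀ (δ M : ℝ) (u v : ℝ → ℝ), DoublingPair δ M u v → δ < ε → M < ε →
      IsSQuasisymmetricGraph s (curveImage u v) := by
  obtain ⟨g₀, g₁, hg⟩ := exists_orderIso_bound one_pos one_pos
  set g := g₁.trans g₀ with hgdef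
  lift s to ℝ≥0 using hs.le
  have hs' : 0 < s := by exact_mod_cast hs
  -- If the ratio on the curve is at most 2 / s, then `g₁` bounds the ratio on the line by `g₁ (2 /
  -- s)`, so affine closeness is needed only up to this scale.
  obtain ⟨ε, hε, hε1, hb⟩ := exists_forall_dist_le (max 1 (g₁ (2 / s) : ℝ≥0)) (s / 2)
    (le_max_left _ _) (by positivity)
  -- Subtraction in `ℝ≥0` is truncated: the last term vanishes for t ≤ 1 / s, leaving at most t + s
  -- / 2. For t ≥ 2 / s one has t ≤ 2 (t - 1 / s), so that term dominates `g t` and the minimum is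
  -- `g t`.
  obtain ⟨η, hη⟩ : ∃ η : ℝ≥0 ≃o ℝ≥0, ∀ t, η t = min (g t) (t + s / 2 + g (2 * (t - 1 / s))) := by
    apply NNReal.exists_orderIso_eq
    · have := g.continuous
      fun_prop
    · intro x y hxy
      apply lt_min
      · exact (min_le_left _ _).trans_lt (g.strictMono hxy)
      · refine (min_le_right _ _).trans_lt ?_
        have : g (2 * (x - 1 / s)) ≤ g (2 * (y - 1 / s)) := g.monotone (by gcongr)
        have : x + s / 2 < y + s / 2 := by gcongr
        exact add_lt_add_of_lt_of_le this ‹_›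
    · have : g 0 = 0 := g.map_bot
      simp [this]
    · intro y
      refine ⟨max (g.symm y) y, le_min ?_ ?_⟩
      · rw [← g.symm_apply_le]
        exact le_max_left _ _
      · exact (le_max_right _ _).trans (le_self_add.trans le_self_add)
  refine ⟨ε, hε, fun δ M u v H hδ hM => ⟨H.isHomeomorph_realProj, η.toHomeomorph,
    H.isQuasisymmetricWith_realProj fun a b x hxa hxb => ?_, ?_⟩⟩
  · obtain ⟨h1, h2⟩ := hg u v (H.weaken (hδ.le.trans hε1) (hM.le.trans hε1)) a b x hxa hxb
    have h3 := hb δ M u v H hδ hM a b x hxb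
    set τ := nndist (curve u v x) (curve u v a) / nndist (curve u v x) (curve u v b) with hτ
    have h4 : nndist (u x) (u a) ≤ g τ * nndist (u x) (u b) := by
      refine h1.trans ?_
      gcongr
      exact g₀.monotone h2
    rw [hη]
    rcases le_total (g τ) (τ + s / 2 + g (2 * (τ - 1 / s))) with hm | hm
    · rwa [min_eq_left hm]
    · rw [min_eq_right hm]
      rcases le_total τ (2 / s) with hτs | hτs
      · have h5 : dist x a / dist x b ≤ max 1 (g₁ (2 / s) : ℝ) := by
          apply le_max_of_le_right
          exact_mod_cast h2.trans (g₁.monotone hτs)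
        have h6 : nndist (u x) (u a) ≤ (τ + s / 2) * nndist (u x) (u b) := by
          exact_mod_cast h3 h5
        exact h6.trans (mul_le_mul_left le_self_add _)
      · refine h4.trans ?_
        gcongr
        have h7 : τ ≤ 2 * (τ - 1 / s) := by
          have e : 1 / s ≤ τ := le_trans (by gcongr; norm_num) hτs
          rw [← NNReal.coe_le_coe] at hτs ⊢
          push_cast [NNReal.coe_sub e] at hτs ⊢
          have : (2 : ℝ) / s = 2 * (1 / s) := by ring
          linarith
        exact (g.monotone h7).trans le_add_self
  · intro t ht
    have ht' : t ≤ 1 / s := by exact_mod_cast ht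
    have h0 : g 0 = 0 := g.map_bot
    have : η t ≤ t + s := by
      rw [hη, tsub_eq_zero_of_le ht', mul_zero, h0, add_zero]
      refine (min_le_right _ _).trans ?_
      gcongr
      exact NNReal.half_le_self s
    exact_mod_cast this

end DoublingPair

theorem mainTheorem3 :
    (∀ (μ : Measure ℝ) [IsLocallyFiniteMeasure μ] (u v : ℝ → ℝ),
      IsDoubling μ → HasMeasureDeriv u μ → MemZygmund μ v →
        IsQuasisymmetricGraph (curveImage u v)) ∧
    (∀ s : ℝ, 0 < s → ∃ ε : ℝ, 0 < ε ∧
      ∀ (μ : Measure ℝ) [IsLocallyFiniteMeasure μ] (u v : ℝ → ℝ),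
        IsDoubling μ → HasMeasureDeriv u μ → MemZygmund μ v →
        doublingConstant μ < ε → zygmundSeminorm μ v < ε →
          IsSQuasisymmetricGraph s (curveImage u v)) := by
  constructor
  · rintro μ _ u v ⟨h0, δ, hδ, hμ⟩ hu ⟨hc, M, hM, hv⟩
    exact (DoublingPair.of_measure hu h0 hδ hμ hM hc hv).isQuasisymmetricGraph
  · intro s hs
    obtain ⟨ε, hε, h⟩ := DoublingPair.exists_forall_isSQuasisymmetricGraph hs
    refine ⟨ε, hε, ?_⟩
    rintro μ _ u v ⟨h0, hμ⟩ hu ⟨hc, hv⟩ hdε hzε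
    -- The admissible constants form a nonempty set, so an infimum below ε is witnessed by one of
    -- them below ε.
    obtain ⟨δ, ⟨hδ, hμδ⟩, hδε⟩ := exists_lt_of_csInf_lt hμ hdε
    obtain ⟨M, ⟨hM, hvM⟩, hMε⟩ := exists_lt_of_csInf_lt hv hzε
    exact h δ M u v (DoublingPair.of_measure hu h0 hδ hμδ hM hc hvM) hδε hMε
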